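/- **Setting.** Let $N\ge 2$ agents $\mathcal N=\{1,\dots,N\}$ be the vertices of a strongly connected directed graph without self-loops; $\mathcal N(i)$ denotes the set of out-neighbours of $i$, and $d(i,r)$ the length of a shortest directed path from $i$ to $r$. For $i\ne r$ let $n(i,r)\in\mathcal N(i)$ be an out-neighbour of $i$ on a shortest path from $i$ to $r$, so that $d(n(i,r),r)=d(i,r)-1$; let $n(i,i)\in\mathcal N(i)$ be arbitrary. Agent $i$ sends a message $m_i=(y_i,q_i)\in\mathcal M_i=\mathbb R\times\mathbb R^N$, with $q_i=(q_i^1,\dots,q_i^N)$. Write $\mathcal M=\mathcal M_1\times\dots\times\mathcal M_N$. For parameters $\xi\in(0,1)$ and $\delta>0$ put $$Q_i(m)=\sum_{r\in\mathcal N(i)}\frac{q_r^r}{\xi}+\sum_{r\notin\mathcal N(i),\,r\ne i}\frac{q_{n(i,r)}^r}{\xi^{d(i,r)-1}},\qquad \hat x_i(m)=\frac1N\bigl(y_i+Q_i(m)\bigr),$$ $$\hat p_i(m_{-i})=\delta(N-1)\Bigl(\frac{q_{n(i,i)}^i}{\xi}-\frac{1}{N-1}Q_i(m)\Bigr),$$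 $$\hat t_i(m)=\hat p_i(m_{-i})\,\hat x_i(m)+(q_i^i-\xi y_i)^2+\sum_{r\in\mathcal N(i)}(q_i^r-\xi y_r)^2+\sum_{r\notin\mathcal N(i),\,r\ne i}(q_i^r-\xi q_{n(i,r)}^r)^2+\frac{\delta}{2}(q_{n(i,i)}^i-\xi y_i)^2 .$$ For valuations $v_i:\mathbb R\to\mathbb R$, the game $\mathfrak G_{pub}$ has action sets $\mathcal M_i$ and payoffs $u_i(m)=v_i(\hat x_i(m))-\hat t_i(m)$. The best response of agent $i$ is $\beta_i(m_{-i})=\arg\max_{m_i\in\mathcal M_i}u_i(m_i,m_{-i})$. The model with parameter $\eta>1$ admits the valuations that are twice continuously differentiable and strictly concave with $v_i''(x)\in(-\eta,-1/\eta)$ for all $x$. The space $\mathcal M$ carries the coordinatewise order and the supremum metric over all scalar coordinates (the metric that corresponds to the row-sum norm $\|A\|=\max_a\sum_b|A_{ab}|$). A learning dynamic is a sequence of mixed strategy profiles $\mu_t$ with independent components, with realized actions $m_t\in S(\mu_t)$, where $S(\mu_t)\subseteq\mathcal M$ is the support. For a given Nash equilibrium $\tilde m$ let $B(\mathcal M')$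 be the smallest closed ball centred at $\tilde m$ containing $\mathcal M'$. The dynamic is an adaptive best-response (ABR) dynamic if for every $s$ there is $T>s$ such that $S(\mu_t)\subseteq B\bigl(\beta(B(\{m_s,\dots,m_{t-1}\}))\bigr)$ for all $t\ge T$. **Theorem (Contraction, public goods).** There is a function $\delta(\cdot)$ (depending only on the graph and the maps $n,d$), positive on $\bigl(\sqrt{(N-1)/N},1\bigr)$, such that for every $\eta>1$ there is $\xi_0\in\bigl[\sqrt{(N-1)/N},1\bigr)$ such that for every $\xi\in(\xi_0,1)$, with $\delta=\delta(\xi)$, and for every profile $(v_i)$ of valuations admitted by the model with parameter $\eta$, the following hold for $\mathfrak G_{pub}$. 1. *Contraction.* The best response is single-valued and defines a differentiable map $\beta=(\beta_i)_i:\mathcal M\to\mathcal M$; there is $K<1$ such that the row-sum norm of the Jacobian of $\beta$ is at most $K$ at every point, and $\beta$ is $K$-Lipschitz in the supremum metric. 2. *Supermodularity.* Each $u_i$ is supermodular in $m_i$ and has increasing differences in $(m_i,m_{-i})$, and each $\beta_i$ is nondecreasing in the messages of the other agents. 3. *Learning.* There is a unique Nash equilibrium $\tilde m$, and for every ABR dynamic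 $m_t\to\tilde m$; moreover, for every $\varepsilon>0$ the support $S(\mu_t)$ lies in the closed ball of radius $\varepsilon$ about $\tilde m$ for all sufficiently large $t$. -/

import Mathlib

open MeasureTheory Filter Topology
open scoped NNReal

noncomputable section

namespace PublicGoods

/-! ### The communication graph -/

/-- Every agent can be reached from every other agent along directed edges.
An edge `G.Adj i j` means that `i` listens to `j`, so the out-neighbours of `i` are
the `j` with `G.Adj i j`. -/
def StronglyConnected {V : Type*} (G : Digraph V) : Prop :=
  ∀ i j, Relation.ReflTransGen G.Adj i j

/-- There is a directed walk with `k` edges from `i` to `j`. -/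
def HasWalk {V : Type*} (G : Digraph V) (i j : V) (k : ℕ) : Prop :=
  ∃ p : ℕ → V, p 0 = i ∧ p k = j ∧ ∀ t < k, G.Adj (p t) (p (t + 1))

/-- The length of a shortest directed path from `i` to `j`. -/
def dist {V : Type*} (G : Digraph V) (i j : V) : ℕ :=
  sInf {k | HasWalk G i j k}

/-- `n i r` is the out-neighbour of `i` through which a chosen shortest path from `i` to `r ≠ i`
goes; `n i i` is an arbitrary out-neighbour of `i`. -/
def IsNextHop {V : Type*} (G : Digraph V) (n : V → V → V) : Prop :=
  (∀ i r, G.Adj i (n i r)) ∧ ∀ i r, i ≠ r → dist G i r = dist G (n i r) r + 1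

/-! ### Messages and the mechanism -/

/-- The message `(y, q)` of one agent: a contribution `y` and proxies `q` for the contributions
of all agents. -/
abbrev Msg (N : ℕ) : Type := ℝ × (Fin N → ℝ)

/-- Message profiles, with the coordinatewise order and the supremum metric over all
coordinates. -/
abbrev Profile (N : ℕ) : Type := Fin N → Msg N

/-- The free parameters and the routing data of the mechanism. -/
structure Params (N : ℕ) where
  /-- The communication graph. -/
  G : Digraph (Fin N)
  /-- The next-hop map. -/
  n : Fin N → Fin N → Fin N
  /-- The contraction parameter. -/
  ξ : ℝ
  /-- The price parameter. -/
  δ : ℝ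

namespace Params

variable {N : ℕ} (M : Params N)

open scoped Classical in
/-- The out-neighbours of `i`. -/
def nbrs (i : Fin N) : Finset (Fin N) :=
  Finset.univ.filter fun r => M.G.Adj i r

open scoped Classical in
/-- The agents other than `i` that are not out-neighbours of `i`. -/
def far (i : Fin N) : Finset (Fin N) :=
  Finset.univ.filter fun r => ¬ M.G.Adj i r ∧ r ≠ i

/-- The allocation function of agent `i`. -/
def alloc (i : Fin N) (m : Profile N) : ℝ :=
  1 / (N : ℝ) *
    ((m i).1 + ∑ r ∈ M.nbrs i, (m r).2 r / M.ξ
      + ∑ r ∈ M.far i, (m (M.n i r)).2 r / M.ξ ^ (dist M.G i r - 1))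

/-- The price faced by agent `i`. -/
def price (i : Fin N) (m : Profile N) : ℝ :=
  M.δ * ((N : ℝ) - 1) *
    ((m (M.n i i)).2 i / M.ξ
      - 1 / ((N : ℝ) - 1) * ∑ r ∈ M.nbrs i, (m r).2 r / M.ξ
      - 1 / ((N : ℝ) - 1) *
          ∑ r ∈ M.far i, (m (M.n i r)).2 r / M.ξ ^ (dist M.G i r - 1))

/-- The tax function of agent `i`. -/
def tax (i : Fin N) (m : Profile N) : ℝ :=
  M.price i m * M.alloc i m
    + ((m i).2 i - M.ξ * (m i).1) ^ 2
    + ∑ r ∈ M.nbrs i, ((m i).2 r - M.ξ * (m r).1) ^ 2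
    + ∑ r ∈ M.far i, ((m i).2 r - M.ξ * (m (M.n i r)).2 r) ^ 2
    + M.δ / 2 * ((m (M.n i i)).2 i - M.ξ * (m i).1) ^ 2

/-- The payoffs of the game induced by the valuations `v`. -/
def payoff (v : Fin N → ℝ → ℝ) (i : Fin N) (m : Profile N) : ℝ :=
  v i (M.alloc i m) - M.tax i m

end Params

/-- The valuations admitted by the model with parameter `η`. -/
def IsValuation (η : ℝ) (v : ℝ → ℝ) : Prop :=
  ContDiff ℝ 2 v ∧ StrictConcaveOn ℝ Set.univ v ∧
    ∀ x, deriv (deriv v) x ∈ Set.Ioo (-η) (-(1 / η))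

/-! ### Games on message profiles -/

variable {N : ℕ}

/-- `b` is a best response to `m`: every `b i` maximizes the payoff of agent `i` against the
messages of the others in `m`. -/
def IsBestResponse (u : Fin N → Profile N → ℝ) (m b : Profile N) : Prop :=
  ∀ i, ∀ a : Msg N, u i (Function.update m i a) ≤ u i (Function.update m i (b i))

/-- `m` is a (pure) Nash equilibrium. -/
def IsNash (u : Fin N → Profile N → ℝ) (m : Profile N) : Prop :=
  ∀ i, ∀ a : Msg N, u i (Function.update m i a) ≤ u i m

/-- Each payoff is supermodular in the player's own message and has increasing differences in
the own message and the profile of the messages of the others. -/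
def IsSupermodular (u : Fin N → Profile N → ℝ) : Prop :=
  (∀ i (m : Profile N) (a b : Msg N),
    u i (Function.update m i a) + u i (Function.update m i b) ≤
      u i (Function.update m i (a ⊔ b)) + u i (Function.update m i (a ⊓ b))) ∧
  (∀ i (m m' : Profile N) (a a' : Msg N), m ≤ m' → a ≤ a' →
    u i (Function.update m i a') - u i (Function.update m i a) ≤
      u i (Function.update m' i a') - u i (Function.update m' i a))

/-! ### The Jacobian and its row-sum norm -/

/-- Labels of the scalar coordinates of a profile: `(i, none)` is `y_i`, and `(i, some w)` is
`q_i^w`. -/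
abbrev Coord (N : ℕ) : Type := Fin N × Option (Fin N)

/-- The scalar coordinate of a profile with the given label. -/
def coord (m : Profile N) : Coord N → ℝ
  | (i, none) => (m i).1
  | (i, some w) => (m i).2 w

/-- The profile whose coordinate with the given label is one and whose others are zero. -/
def unitProfile : Coord N → Profile N
  | (i, none) => Pi.single i (1, 0)
  | (i, some w) => Pi.single i (0, Pi.single w 1)

/-- The matrix of partial derivatives of `β` at `m`; the row index is the component of `β`. -/
def jacobian (β : Profile N → Profile N) (m : Profile N) : Matrix (Coord N) (Coord N) ℝ :=
  fun a b => coord (fderiv ℝ β m (unitProfile b)) a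

/-- The row-sum norm of a matrix. -/
def rowSumNorm (A : Matrix (Coord N) (Coord N) ℝ) : ℝ :=
  ⨆ a, ∑ b, |A a b|

/-! ### Adaptive best-response dynamics -/

/-- The smallest closed ball centred at `c` that contains `S` (the whole space when `S` is
unbounded). -/
def ballHull (c : Profile N) (S : Set (Profile N)) : Set (Profile N) :=
  ⋂ ρ ∈ {ρ : ℝ | S ⊆ Metric.closedBall c ρ}, Metric.closedBall c ρ

/-- The support of the mixed strategy profile with independent components `μ i`. -/
def mixedSupport (μ : Fin N → ProbabilityMeasure (Msg N)) : Set (Profile N) :=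
  (Measure.pi fun i => (μ i : Measure (Msg N))).support

/-- `μ t` is the mixed strategy profile at time `t` and `m t` the action realized at time `t`.
The dynamic is an adaptive best-response dynamic for the best-response map `β` and the
equilibrium `c`: for every `s`, from some time on, the support at time `t` lies in the smallest
ball about `c` that contains the best responses to the smallest ball about `c` that contains the
actions realized at the times `s, …, t - 1`. -/
def IsABR (β : Profile N → Profile N) (c : Profile N)
    (μ : ℕ → Fin N → ProbabilityMeasure (Msg N)) (m : ℕ → Profile N) : Prop :=
  (∀ t, m t ∈ mixedSupport (μ t)) ∧
  ∀ s, ∃ T > s, ∀ t ≥ T,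
    mixedSupport (μ t) ⊆ ballHull c (β '' ballHull c (m '' Set.Ico s t))

end PublicGoods

end

/-!
The mechanism makes the best response almost linear. Against fixed messages of the others the
proxies of agent `i` enter the payoff only through separate squares, so they are set to `ξ` times
the quantity they track. What remains is a strictly concave problem in `y = y_i`. With
`Q = aggregate i m` (what agent `i` infers about the contributions of the others) and
`a = probe i m` (the proxy for `y_i` that agent `i` reads off a neighbour), its first-order
condition is `H (y + Q) = c₁ Q + c₂ a`, where `H X = δ ξ² X - v_i' (X / N) / N` is an increasing
bijection of the line with differentiable inverse. Hence the best response is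
`y = H⁻¹ (c₁ Q + c₂ a) - Q`, without any appeal to the implicit function theorem, and by the mean
value theorem its increments are
`Δy = ((δ / N - w) ΔQ + δ (ξ - (N - 1) / (N ξ)) Δa) / (δ ξ² + w)` for some `w` between
`1 / (η N²)` and `η / N²` (`exists_increment_contribution`).

Both coefficients are nonnegative once `δ ≥ η / N` and `ξ² ≥ (N - 1) / N`; this gives monotone best
responses, and the same two inequalities give increasing differences. The Lipschitz constant in
the supremum metric is below one as soon as `δ` times
`slack ξ = S / N - (N - 1) / (N ξ) + ξ - ξ²` is smaller than `1 / (η N²)`, where `S` is the sum of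
the weights in `Q`. As `S = N - 1` at `ξ = 1`, the slack vanishes to first order there, so the
choice `δ = (1 - ξ)^(-1/2)` makes `δ` large and `δ` times the slack small at the same time,
whatever `η` is.

The bound on the Jacobian follows from monotonicity and the Lipschitz bound
(`rowSumNorm_jacobian_le`): its entries are nonnegative, so its row sums are the coordinates of the
derivative in the direction of the profile of ones. The learning statement follows by repeating
the contraction along the adaptive dynamic (`IsABR.eventually_subset`).
-/

namespace PublicGoods

/-! ### Valuations -/

namespace IsValuation

variable {η : ℝ} {v : ℝ → ℝ}

theorem differentiable (hv : IsValuation η v) : Differentiable ℝ v :=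
  hv.1.differentiable (by norm_num)

theorem differentiable_deriv (hv : IsValuation η v) : Differentiable ℝ (deriv v) := by
  have h : ContDiff ℝ (1 + 1) v := by
    have := hv.1
    norm_num
    exact this
  exact ((contDiff_succ_iff_deriv.1 h).2.2).differentiable (by norm_num)

/-- The mean value theorem for the marginal valuation. -/
theorem exists_deriv_sub_eq (hv : IsValuation η v) (x y : ℝ) :
    ∃ w ∈ Set.Ioo (1 / η) η, deriv v y - deriv v x = -w * (y - x) := by
  have key : ∀ x y, x < y → ∃ w ∈ Set.Ioo (1 / η) η, deriv v y - deriv v x = -w * (y - x) := by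
    intro x y hxy
    obtain ⟨c, -, hc⟩ := exists_deriv_eq_slope (deriv v) hxy
      hv.differentiable_deriv.continuous.continuousOn hv.differentiable_deriv.differentiableOn
    obtain ⟨h1, h2⟩ := hv.2.2 c
    refine ⟨-deriv (deriv v) c, ⟨by linarith, by linarith⟩, ?_⟩
    rw [hc, neg_neg, div_mul_cancel₀ _ (sub_pos.2 hxy).ne']
  rcases lt_trichotomy x y with h | h | h
  · exact key x y h
  · obtain ⟨h1, h2⟩ := hv.2.2 x
    exact ⟨-deriv (deriv v) x, ⟨by linarith, by linarith⟩, by simp [h]⟩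
  · obtain ⟨w, hw, e⟩ := key y x h
    exact ⟨w, hw, by linarith⟩

/-- As `v'' > -η`, the function `v x + η x² / 2` is convex, so its increments over a fixed step grow
with the base point. -/
theorem increment_add_le (hv : IsValuation η v) {x x' e : ℝ} (hx : x ≤ x') (he : 0 ≤ e) :
    v x' - v x ≤ v (x' + e) - v (x + e) + η * e * (x' - x) := by
  have hd : ∀ s, HasDerivAt (fun s => v (x' + s) - v (x + s) + η * s * (x' - x))
      (deriv v (x' + s) - deriv v (x + s) + η * (x' - x)) s := by
    intro s
    have h1 := (hv.differentiable (x' + s)).hasDerivAt.comp_const_add x' s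
    have h2 := (hv.differentiable (x + s)).hasDerivAt.comp_const_add x s
    have h3 := ((hasDerivAt_id s).const_mul η).mul_const (x' - x)
    exact ((h1.sub h2).add h3).congr_deriv (by simp)
  have hm : Monotone fun s => v (x' + s) - v (x + s) + η * s * (x' - x) := by
    refine monotone_of_hasDerivAt_nonneg hd fun s => ?_
    obtain ⟨w, hw, e⟩ := hv.exists_deriv_sub_eq (x + s) (x' + s)
    have := mul_le_mul_of_nonneg_right hw.2.le (sub_nonneg.2 hx)
    simp only [Pi.zero_apply]
    rw [e]
    linarith
  simpa using hm he

/-- The left-hand side of the first-order condition is a bijection of the line, with a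
differentiable inverse. -/
theorem exists_inverse_marginal (hv : IsValuation η v) (hη : 0 < η) {κ ν : ℝ} (hκ : 0 < κ)
    (hν : 0 < ν) :
    ∃ ρ : ℝ → ℝ, Differentiable ℝ ρ ∧ ∀ z, κ * ρ z - deriv v (ρ z / ν) / ν = z := by
  set H : ℝ → ℝ := fun X => κ * X - deriv v (X / ν) / ν with hH
  have hη' : 0 < 1 / η := by positivity
  have hinc : ∀ X Y, X ≤ Y → H X + κ * (Y - X) ≤ H Y := by
    intro X Y hXY
    obtain ⟨w, hw, e⟩ := hv.exists_deriv_sub_eq (X / ν) (Y / ν)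
    have hw0 : 0 < w := hη'.trans hw.1
    have h1 : 0 ≤ w * (Y / ν - X / ν) / ν := by
      have := div_le_div_of_nonneg_right hXY hν.le
      have := sub_nonneg.2 this
      positivity
    have h2 : deriv v (Y / ν) / ν - deriv v (X / ν) / ν = -(w * (Y / ν - X / ν) / ν) := by
      rw [← sub_div, e]; ring
    simp only [hH]
    linarith
  have hmono : StrictMono H := by
    intro X Y hXY
    have := hinc X Y hXY.le
    have := mul_pos hκ (sub_pos.2 hXY)
    linarith
  have hdiff : Differentiable ℝ H := by
    have := hv.differentiable_deriv
    fun_prop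
  have hsurj : Function.Surjective H := by
    refine hdiff.continuous.surjective ?_ ?_
    · refine tendsto_atTop_mono' _ (f₁ := fun X => H 0 + κ * X) ?_ ?_
      · filter_upwards [eventually_ge_atTop 0] with X hX
        simpa using hinc 0 X hX
      · exact tendsto_atTop_add_const_left _ _ (tendsto_id.const_mul_atTop hκ)
    · refine tendsto_atBot_mono' _ (f₁ := fun X => H 0 + κ * X) ?_ ?_
      · filter_upwards [eventually_le_atBot 0] with X hX
        have := hinc X 0 hX
        linarith
      · exact tendsto_atBot_add_const_left _ _ (tendsto_id.const_mul_atBot hκ)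
  let e := hmono.orderIsoOfSurjective H hsurj
  have he : ∀ z, H (e.symm z) = z := fun z => e.apply_symm_apply z
  refine ⟨e.symm, fun z => ?_, he⟩
  have hd : HasDerivAt H (κ - deriv (deriv v) (e.symm z / ν) * (1 / ν) / ν) (e.symm z) := by
    have h1 : HasDerivAt (fun X : ℝ => X / ν) (1 / ν) (e.symm z) := (hasDerivAt_id _).div_const ν
    have h2 := (hv.differentiable_deriv (e.symm z / ν)).hasDerivAt.comp (e.symm z) h1
    have h3 := ((hasDerivAt_id (e.symm z)).const_mul κ).sub (h2.div_const ν)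
    exact h3.congr_deriv (by simp)
  refine (hd.of_local_left_inverse e.symm.continuous.continuousAt ?_
    (Eventually.of_forall he)).differentiableAt
  have h1 := (hv.2.2 (e.symm z / ν)).2
  have h2 : 0 < -deriv (deriv v) (e.symm z / ν) * (1 / ν) / ν := by
    have : 0 < -deriv (deriv v) (e.symm z / ν) := by linarith
    positivity
  have : 0 < κ - deriv (deriv v) (e.symm z / ν) * (1 / ν) / ν := by
    have : -deriv (deriv v) (e.symm z / ν) * (1 / ν) / ν
      = -(deriv (deriv v) (e.symm z / ν) * (1 / ν) / ν) := by ring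
    linarith
  exact this.ne'

end IsValuation

/-- A critical point of a function with strictly decreasing derivative is its unique maximum. -/
theorem lt_of_hasDerivAt_of_strictAnti {f f' : ℝ → ℝ} (hf : ∀ x, HasDerivAt f (f' x) x)
    (hf' : StrictAnti f') {x₀ x : ℝ} (h₀ : f' x₀ = 0) (hx : x ≠ x₀) : f x < f x₀ := by
  have hc : Continuous f := continuous_iff_continuousAt.2 fun x => (hf x).continuousAt
  rcases hx.lt_or_gt with h | h
  · obtain ⟨c, ⟨-, hc2⟩, e⟩ := exists_hasDerivAt_eq_slope f f' h hc.continuousOn fun x _ => hf x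
    have h1 : 0 < f' c := h₀ ▸ hf' hc2
    rw [e] at h1
    have := (div_pos_iff_of_pos_right (sub_pos.2 h)).1 h1
    linarith
  · obtain ⟨c, ⟨hc1, -⟩, e⟩ := exists_hasDerivAt_eq_slope f f' h hc.continuousOn fun x _ => hf x
    have h1 : f' c < 0 := h₀ ▸ hf' hc1
    rw [e, div_neg_iff] at h1
    rcases h1 with h1 | h1 <;> linarith

/-! ### Coordinates and the Jacobian -/

variable {N : ℕ}

theorem abs_contribution_sub_le (m m' : Profile N) (r : Fin N) :
    |(m' r).1 - (m r).1| ≤ Dist.dist m' m := by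
  rw [← Real.dist_eq]
  exact (le_max_left _ _).trans (dist_le_pi_dist m' m r)

theorem abs_proxy_sub_le (m m' : Profile N) (r s : Fin N) :
    |(m' r).2 s - (m r).2 s| ≤ Dist.dist m' m := by
  rw [← Real.dist_eq]
  exact (dist_le_pi_dist (m' r).2 (m r).2 s).trans
    ((le_max_right _ _).trans (dist_le_pi_dist m' m r))

theorem abs_coord_le (m : Profile N) (a : Coord N) : |coord m a| ≤ ‖m‖ := by
  rcases a with ⟨i, _ | w⟩
  · simpa [coord] using abs_contribution_sub_le 0 m i
  · simpa [coord] using abs_proxy_sub_le 0 m i w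

theorem coord_nonneg {m : Profile N} (hm : 0 ≤ m) (a : Coord N) : 0 ≤ coord m a := by
  rcases a with ⟨i, _ | w⟩
  · exact (hm i).1
  · exact (hm i).2 w

theorem coord_sum {ι : Type*} (s : Finset ι) (f : ι → Profile N) (a : Coord N) :
    coord (∑ j ∈ s, f j) a = ∑ j ∈ s, coord (f j) a := by
  rcases a with ⟨i, _ | w⟩ <;> simp [coord, Finset.sum_apply, Prod.fst_sum, Prod.snd_sum]

theorem unitProfile_nonneg (b : Coord N) : 0 ≤ unitProfile b := by
  rcases b with ⟨i, _ | w⟩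
  · exact Pi.single_nonneg.2 ⟨zero_le_one, le_rfl⟩
  · exact Pi.single_nonneg.2 ⟨le_rfl, Pi.single_nonneg.2 zero_le_one⟩

theorem sum_unitProfile : ∑ b : Coord N, unitProfile b = 1 := by
  rw [Fintype.sum_prod_type]
  funext j
  simp only [Fintype.sum_option, unitProfile, Finset.sum_apply, Pi.add_apply, Pi.one_apply]
  ext w <;> simp [Prod.fst_sum, Prod.snd_sum, Finset.sum_apply, Pi.single_apply,
    Finset.sum_ite_eq, Finset.sum_add_distrib]

/-- A monotone map has nonnegative derivatives in nonnegative directions. -/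
theorem fderiv_nonneg_of_monotone {β : Profile N → Profile N} (hβ : Monotone β) {m h : Profile N}
    (hd : DifferentiableAt ℝ β m) (hh : 0 ≤ h) : 0 ≤ fderiv ℝ β m h := by
  have hl := hd.hasFDerivAt.hasLineDerivAt h
  have ht := hl.tendsto_slope_zero_right
  refine ge_of_tendsto ht ?_
  filter_upwards [self_mem_nhdsWithin] with t ht
  have ht : (0 : ℝ) < t := ht
  have h1 : β m ≤ β (m + t • h) := hβ (le_add_of_nonneg_right (smul_nonneg ht.le hh))
  have := smul_nonneg (inv_nonneg.2 ht.le) (sub_nonneg.2 h1)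
  simpa using this

/-- For a monotone map the absolute row sums of the Jacobian are the coordinates of the derivative
in the direction of the profile of ones, so a Lipschitz constant bounds them. -/
theorem rowSumNorm_jacobian_le [NeZero N] {β : Profile N → Profile N} (hβ : Monotone β) {K : ℝ≥0}
    (hK : LipschitzWith K β) (m : Profile N) (hd : DifferentiableAt ℝ β m) :
    rowSumNorm (jacobian β m) ≤ K := by
  refine ciSup_le fun a => ?_
  have h1 : ∑ b, |jacobian β m a b| = coord (fderiv ℝ β m 1) a := by
    rw [← sum_unitProfile, map_sum, coord_sum]
    refine Finset.sum_congr rfl fun b _ => abs_of_nonneg ?_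
    exact coord_nonneg (fderiv_nonneg_of_monotone hβ hd (unitProfile_nonneg b)) a
  rw [h1]
  calc coord (fderiv ℝ β m 1) a ≤ ‖fderiv ℝ β m 1‖ := (le_abs_self _).trans (abs_coord_le _ a)
    _ ≤ ‖fderiv ℝ β m‖ * ‖(1 : Profile N)‖ := ContinuousLinearMap.le_opNorm _ _
    _ ≤ K * 1 := by
        gcongr
        · exact norm_fderiv_le_of_lipschitz ℝ hK
        · refine (pi_norm_le_iff_of_nonneg zero_le_one).2 fun i => ?_
          refine max_le (by simp) ((pi_norm_le_iff_of_nonneg zero_le_one).2 fun r => by simp)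
    _ = K := mul_one _

/-! ### Adaptive best-response dynamics -/

theorem ballHull_subset {c : Profile N} {S : Set (Profile N)} {ρ : ℝ}
    (h : S ⊆ Metric.closedBall c ρ) : ballHull c S ⊆ Metric.closedBall c ρ :=
  Set.biInter_subset_of_mem (t := fun ρ => Metric.closedBall c ρ) h

section Dynamics

variable {β : Profile N → Profile N} {c : Profile N} {K : ℝ≥0}
  {μ : ℕ → Fin N → ProbabilityMeasure (Msg N)} {m : ℕ → Profile N}

theorem ballHull_image_subset (hK : LipschitzWith K β) (hc : β c = c) {S : Set (Profile N)}
    {ρ : ℝ} (h : S ⊆ Metric.closedBall c ρ) :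
    ballHull c (β '' ballHull c S) ⊆ Metric.closedBall c (K * ρ) := by
  refine ballHull_subset ?_
  rintro _ ⟨x, hx, rfl⟩
  have h1 := hK.dist_le_mul x c
  rw [hc] at h1
  exact h1.trans (mul_le_mul_of_nonneg_left (ballHull_subset h hx) K.2)

/-- The realized actions stay within a bounded distance of the equilibrium. -/
theorem IsABR.exists_bound (hK : LipschitzWith K β) (hK1 : K ≤ 1) (hc : β c = c)
    (h : IsABR β c μ m) : ∃ R : ℝ, ∀ t, Dist.dist (m t) c ≤ R := by
  obtain ⟨T, -, hT⟩ := h.2 0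
  refine ⟨∑ k ∈ Finset.range T, Dist.dist (m k) c, ?_⟩
  set R := ∑ k ∈ Finset.range T, Dist.dist (m k) c
  have hR : 0 ≤ R := Finset.sum_nonneg fun _ _ => dist_nonneg
  intro t
  induction t using Nat.strong_induction_on with
  | _ t ih =>
    rcases lt_or_ge t T with ht | ht
    · exact Finset.single_le_sum (f := fun k => Dist.dist (m k) c) (fun _ _ => dist_nonneg)
        (Finset.mem_range.2 ht)
    · have hS : m '' Set.Ico 0 t ⊆ Metric.closedBall c R := by
        rintro _ ⟨k, hk, rfl⟩
        exact ih k hk.2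
      have h1 := ballHull_image_subset hK hc hS (hT t ht (h.1 t))
      exact h1.trans (mul_le_of_le_one_left hR hK1)

/-- From some time on the supports lie in the ball of radius `K ^ k * R`: whenever all actions
from time `s` on are within `K ^ k * R` of the equilibrium, the dynamic restarted at `s` gains
another factor `K`. -/
theorem IsABR.eventually_subset_pow (hK : LipschitzWith K β) (hc : β c = c) (h : IsABR β c μ m)
    {R : ℝ} (hR : ∀ t, Dist.dist (m t) c ≤ R) (k : ℕ) :
    ∃ T, ∀ t ≥ T, mixedSupport (μ t) ⊆ Metric.closedBall c ((K : ℝ) ^ (k + 1) * R) := by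
  have step : ∀ ρ : ℝ, ∀ s, (∀ t ≥ s, Dist.dist (m t) c ≤ ρ) →
      ∃ T, ∀ t ≥ T, mixedSupport (μ t) ⊆ Metric.closedBall c (K * ρ) := by
    intro ρ s hs
    obtain ⟨T, -, hT⟩ := h.2 s
    refine ⟨T, fun t ht => (hT t ht).trans (ballHull_image_subset hK hc ?_)⟩
    rintro _ ⟨j, hj, rfl⟩
    exact hs j hj.1
  induction k with
  | zero => simpa using step R 0 fun t _ => hR t
  | succ k ih =>
    obtain ⟨s, hs⟩ := ih
    obtain ⟨T, hT⟩ := step _ s fun t ht => hs t ht (h.1 t)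
    exact ⟨T, fun t ht => (hT t ht).trans_eq (by rw [pow_succ' _ (k + 1), mul_assoc])⟩

theorem IsABR.eventually_subset (hK : ContractingWith K β) (hc : β c = c) (h : IsABR β c μ m)
    {ε : ℝ} (hε : 0 < ε) : ∀ᶠ t in atTop, mixedSupport (μ t) ⊆ Metric.closedBall c ε := by
  obtain ⟨R, hR⟩ := h.exists_bound hK.2 hK.1.le hc
  have hlim : Tendsto (fun k : ℕ => (K : ℝ) ^ (k + 1) * R) atTop (𝓝 (0 * R)) :=
    ((tendsto_add_atTop_iff_nat 1).2
      (tendsto_pow_atTop_nhds_zero_of_lt_one K.2 hK.1)).mul_const R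
  rw [zero_mul] at hlim
  obtain ⟨k, hk⟩ := (hlim.eventually (gt_mem_nhds hε)).exists
  obtain ⟨T, hT⟩ := h.eventually_subset_pow hK.2 hc hR k
  filter_upwards [eventually_ge_atTop T] with t ht
  exact (hT t ht).trans (Metric.closedBall_subset_closedBall hk.le)

theorem IsABR.tendsto (hK : ContractingWith K β) (hc : β c = c) (h : IsABR β c μ m) :
    Tendsto m atTop (𝓝 c) := by
  refine Metric.nhds_basis_closedBall.tendsto_right_iff.2 fun ε hε => ?_
  filter_upwards [h.eventually_subset hK hc hε] with t ht
  exact ht (h.1 t)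

end Dynamics


/-! ### The mechanism -/

namespace Params

variable {N : ℕ} (M : Params N) (v : Fin N → ℝ → ℝ)

/-- What the messages of the others tell agent `i` about the sum of their contributions. -/
noncomputable def aggregate (i : Fin N) (m : Profile N) : ℝ :=
  ∑ r ∈ M.nbrs i, (m r).2 r / M.ξ
    + ∑ r ∈ M.far i, (m (M.n i r)).2 r / M.ξ ^ (PublicGoods.dist M.G i r - 1)

/-- The sum of the coefficients of the messages in `aggregate`. -/
noncomputable def weight (i : Fin N) : ℝ :=
  ∑ _r ∈ M.nbrs i, 1 / M.ξ + ∑ r ∈ M.far i, 1 / M.ξ ^ (PublicGoods.dist M.G i r - 1)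

/-- The proxy for the contribution of agent `i` that agent `i` reads off its neighbour
`n i i`. -/
def probe (i : Fin N) (m : Profile N) : ℝ :=
  (m (M.n i i)).2 i

/-- The coefficient of `probe` in the first-order condition of each agent. -/
noncomputable def probeCoeff : ℝ :=
  M.δ * (M.ξ - ((N : ℝ) - 1) / (N * M.ξ))

/-- The right-hand side of the first-order condition of agent `i`. -/
noncomputable def target (i : Fin N) (m : Profile N) : ℝ :=
  M.δ * (1 / N + M.ξ ^ 2) * M.aggregate i m + M.probeCoeff * M.probe i m

/-- The part of the payoff of agent `i` that depends on its own contribution `y` but not on its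
proxies, given the values `Q` of `aggregate` and `a` of `probe`. -/
noncomputable def contributionPayoff (i : Fin N) (Q a y : ℝ) : ℝ :=
  v i ((y + Q) / N) - M.δ * (((N : ℝ) - 1) * a / M.ξ - Q) * ((y + Q) / N)
    - M.δ / 2 * (a - M.ξ * y) ^ 2

open scoped Classical in
/-- The best response of every agent, where `ρ i` is the inverse of the left-hand side of the
first-order condition as a function of `y_i + aggregate i m`. -/
noncomputable def response (ρ : Fin N → ℝ → ℝ) (m : Profile N) : Profile N := fun i =>
  (ρ i (M.target i m) - M.aggregate i m, fun r =>
    if r = i then M.ξ * (ρ i (M.target i m) - M.aggregate i m)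
    else if M.G.Adj i r then M.ξ * (m r).1 else M.ξ * (m (M.n i r)).2 r)

/-- The properties of the routing data that the analysis of the game uses: there is a second
agent, and agents do not listen to themselves. -/
structure IsAdmissible : Prop where
  two_le : 2 ≤ N
  loopless : ∀ i, ¬ M.G.Adj i i
  hop_adj : ∀ i r, M.G.Adj i (M.n i r)

/-- The range of the parameters `ξ` and `δ`, for curvatures of the valuations in `(1 / η, η)`.
The last condition makes the row sums of the best response smaller than one. -/
structure IsContracting (η : ℝ) : Prop where
  one_lt : 1 < η
  pos : 0 < M.ξ
  lt_one : M.ξ < 1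
  le_sq : ((N : ℝ) - 1) / N ≤ M.ξ ^ 2
  le_price : η ≤ M.δ
  slack_lt : ∀ i, M.δ * (M.weight i / N - ((N : ℝ) - 1) / (N * M.ξ) + M.ξ - M.ξ ^ 2)
    < 1 / (η * N ^ 2)

variable {M v}

theorem mem_nbrs {i r : Fin N} : r ∈ M.nbrs i ↔ M.G.Adj i r := by simp [nbrs]

theorem mem_far {i r : Fin N} : r ∈ M.far i ↔ ¬ M.G.Adj i r ∧ r ≠ i := by simp [far]

namespace IsAdmissible

theorem natCast_pos (hM : M.IsAdmissible) : (0 : ℝ) < N := by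
  have := hM.two_le
  exact_mod_cast (by omega : 0 < N)

theorem two_le_cast (hM : M.IsAdmissible) : (2 : ℝ) ≤ N := by exact_mod_cast hM.two_le

theorem ne_of_mem_nbrs (hM : M.IsAdmissible) {i r : Fin N} (h : r ∈ M.nbrs i) : r ≠ i := by
  rintro rfl
  exact hM.loopless _ (mem_nbrs.1 h)

theorem hop_ne (hM : M.IsAdmissible) (i r : Fin N) : M.n i r ≠ i := fun h =>
  hM.loopless i (by simpa [h] using hM.hop_adj i r)

theorem card_nbrs_add_card_far (hM : M.IsAdmissible) (i : Fin N) :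
    ((M.nbrs i).card : ℝ) + (M.far i).card = N - 1 := by
  classical
  have hd : Disjoint (M.nbrs i) (M.far i) :=
    Finset.disjoint_left.2 fun r h1 h2 => (mem_far.1 h2).1 (mem_nbrs.1 h1)
  have hu : M.nbrs i ∪ M.far i = Finset.univ.erase i := by
    ext r
    have := hM.loopless i
    simp only [Finset.mem_union, mem_nbrs, mem_far, Finset.mem_erase, Finset.mem_univ, and_true]
    constructor
    · rintro (h | h)
      · rintro rfl; exact this h
      · exact h.2
    · tauto
  have hc := Finset.card_union_of_disjoint hd
  rw [hu, Finset.card_erase_of_mem (Finset.mem_univ _), Finset.card_univ, Fintype.card_fin] at hc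
  have h2 := hM.two_le
  rw [← Nat.cast_add, ← hc, Nat.cast_sub (by omega), Nat.cast_one]

theorem aggregate_update (hM : M.IsAdmissible) (i : Fin N) (m : Profile N) (a : Msg N) :
    M.aggregate i (Function.update m i a) = M.aggregate i m := by
  unfold aggregate
  congr 1
  · refine Finset.sum_congr rfl fun r hr => ?_
    rw [Function.update_of_ne (hM.ne_of_mem_nbrs hr)]
  · refine Finset.sum_congr rfl fun r _ => ?_
    rw [Function.update_of_ne (hM.hop_ne i r)]

theorem probe_update (hM : M.IsAdmissible) (i : Fin N) (m : Profile N) (a : Msg N) :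
    M.probe i (Function.update m i a) = M.probe i m := by
  simp only [probe, Function.update_of_ne (hM.hop_ne i i)]

/-- The payoff separates into a term in the own contribution and squares that determine the
proxies. -/
theorem payoff_update (hM : M.IsAdmissible) (i : Fin N) (m : Profile N) (a : Msg N) :
    M.payoff v i (Function.update m i a)
      = M.contributionPayoff v i (M.aggregate i m) (M.probe i m) a.1
        - (a.2 i - M.ξ * a.1) ^ 2
        - ∑ r ∈ M.nbrs i, (a.2 r - M.ξ * (m r).1) ^ 2
        - ∑ r ∈ M.far i, (a.2 r - M.ξ * (m (M.n i r)).2 r) ^ 2 := by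
  have halloc : M.alloc i (Function.update m i a) = (a.1 + M.aggregate i m) / N := by
    rw [← hM.aggregate_update i m a]
    simp only [alloc, aggregate, Function.update_self]
    ring
  have hprice : M.price i (Function.update m i a)
      = M.δ * (((N : ℝ) - 1) * M.probe i m / M.ξ - M.aggregate i m) := by
    have h1 : (N : ℝ) - 1 ≠ 0 := by linarith [hM.two_le_cast]
    rw [← hM.aggregate_update i m a, ← hM.probe_update i m a]
    simp only [price, aggregate, probe]
    field_simp
    ring
  have hnbrs : ∑ r ∈ M.nbrs i, (a.2 r - M.ξ * (Function.update m i a r).1) ^ 2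
      = ∑ r ∈ M.nbrs i, (a.2 r - M.ξ * (m r).1) ^ 2 :=
    Finset.sum_congr rfl fun r hr => by
      rw [Function.update_of_ne (hM.ne_of_mem_nbrs hr)]
  have hfar : ∑ r ∈ M.far i, (a.2 r - M.ξ * (Function.update m i a (M.n i r)).2 r) ^ 2
      = ∑ r ∈ M.far i, (a.2 r - M.ξ * (m (M.n i r)).2 r) ^ 2 :=
    Finset.sum_congr rfl fun r _ => by rw [Function.update_of_ne (hM.hop_ne i r)]
  have hprobe := hM.probe_update i m a
  rw [probe] at hprobe
  rw [payoff, tax, halloc, hprice, hprobe, Function.update_self, hnbrs, hfar, contributionPayoff]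
  ring

end IsAdmissible

namespace IsContracting

variable {η : ℝ}

theorem eta_pos (hC : M.IsContracting η) : 0 < η := zero_lt_one.trans hC.one_lt

theorem delta_pos (hC : M.IsContracting η) : 0 < M.δ := hC.eta_pos.trans_le hC.le_price

theorem probeCoeff_nonneg (hC : M.IsContracting η) : 0 ≤ M.probeCoeff := by
  have h : M.ξ - ((N : ℝ) - 1) / (N * M.ξ) = (M.ξ ^ 2 - ((N : ℝ) - 1) / N) / M.ξ := by
    have := hC.pos.ne'
    rw [sub_div (M.ξ ^ 2), div_div, pow_two, mul_div_assoc, div_self this, mul_one]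
  rw [probeCoeff, h]
  exact mul_nonneg hC.delta_pos.le (div_nonneg (sub_nonneg.2 hC.le_sq) hC.pos.le)

theorem weight_nonneg (hC : M.IsContracting η) (i : Fin N) : 0 ≤ M.weight i := by
  have := hC.pos
  unfold weight
  positivity

theorem aggregate_mono (hC : M.IsContracting η) (i : Fin N) : Monotone (M.aggregate i) := by
  intro m m' h
  refine add_le_add (Finset.sum_le_sum fun r _ => ?_) (Finset.sum_le_sum fun r _ => ?_)
  · exact div_le_div_of_nonneg_right ((h r).2 r) hC.pos.le
  · exact div_le_div_of_nonneg_right ((h _).2 r) (pow_nonneg hC.pos.le _)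

theorem abs_aggregate_sub_le (hC : M.IsContracting η) (i : Fin N) (m m' : Profile N) :
    |M.aggregate i m' - M.aggregate i m| ≤ M.weight i * Dist.dist m' m := by
  have h : M.aggregate i m' - M.aggregate i m
      = ∑ r ∈ M.nbrs i, ((m' r).2 r - (m r).2 r) / M.ξ
        + ∑ r ∈ M.far i, ((m' (M.n i r)).2 r - (m (M.n i r)).2 r)
          / M.ξ ^ (PublicGoods.dist M.G i r - 1) := by
    simp only [aggregate, sub_div, Finset.sum_sub_distrib]
    ring
  rw [h, weight, add_mul, Finset.sum_mul, Finset.sum_mul]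
  refine (abs_add_le _ _).trans (add_le_add ?_ ?_)
  · refine (Finset.abs_sum_le_sum_abs _ _).trans (Finset.sum_le_sum fun r _ => ?_)
    rw [abs_div, abs_of_pos hC.pos, one_div_mul_eq_div]
    exact div_le_div_of_nonneg_right (abs_proxy_sub_le m m' _ _) hC.pos.le
  · refine (Finset.abs_sum_le_sum_abs _ _).trans (Finset.sum_le_sum fun r _ => ?_)
    have := pow_pos hC.pos (PublicGoods.dist M.G i r - 1)
    rw [abs_div, abs_of_pos this, one_div_mul_eq_div]
    exact div_le_div_of_nonneg_right (abs_proxy_sub_le m m' _ _) this.le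

end IsContracting

/-! ### Supermodularity -/

/-- A function of one linearly ordered coordinate is modular. -/
theorem map_sup_add_map_inf {α : Type*} [LinearOrder α] (f : α → ℝ) (x y : α) :
    f (x ⊔ y) + f (x ⊓ y) = f x + f y := by
  rcases le_total x y with h | h <;> simp [h, add_comm]

/-- Minus the square of `q - ξ y` is supermodular in `(y, q)` as the product `q y` is. -/
theorem sq_sup_add_sq_inf_le {ξ : ℝ} (hξ : 0 ≤ ξ) (q q' y y' : ℝ) :
    (q ⊔ q' - ξ * (y ⊔ y')) ^ 2 + (q ⊓ q' - ξ * (y ⊓ y')) ^ 2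
      ≤ (q - ξ * y) ^ 2 + (q' - ξ * y') ^ 2 := by
  rcases le_total q q' with h | h <;> rcases le_total y y' with k | k <;> simp only [h, k,
    sup_of_le_left, sup_of_le_right, inf_of_le_left, inf_of_le_right] <;>
    nlinarith [mul_nonneg hξ (mul_nonneg (sub_nonneg.2 h) (sub_nonneg.2 k))]

theorem sq_sub_sq_le {ξ : ℝ} (hξ : 0 ≤ ξ) {q q' s s' : ℝ} (hq : q ≤ q') (hs : s ≤ s') :
    (q' - ξ * s') ^ 2 - (q - ξ * s') ^ 2 ≤ (q' - ξ * s) ^ 2 - (q - ξ * s) ^ 2 := by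
  nlinarith [mul_nonneg hξ (mul_nonneg (sub_nonneg.2 hq) (sub_nonneg.2 hs))]

theorem contributionPayoff_increasing_differences {η : ℝ} (hM : M.IsAdmissible)
    (hC : M.IsContracting η) (i : Fin N) (hv : IsValuation η (v i)) {Q Q' a a' y y' : ℝ}
    (hQ : Q ≤ Q') (ha : a ≤ a') (hy : y ≤ y') :
    M.contributionPayoff v i Q a y' - M.contributionPayoff v i Q a y
      ≤ M.contributionPayoff v i Q' a' y' - M.contributionPayoff v i Q' a' y := by
  have hN := hM.natCast_pos
  have hN2 := hM.two_le_cast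
  have h1 := hv.increment_add_le (x := (y + Q) / N) (x' := (y' + Q) / N) (e := (Q' - Q) / N)
    (by gcongr) (div_nonneg (sub_nonneg.2 hQ) hN.le)
  rw [← add_div, ← add_div, show y' + Q + (Q' - Q) = y' + Q' by ring,
    show y + Q + (Q' - Q) = y + Q' by ring] at h1
  have h2 : 0 ≤ M.probeCoeff * ((a' - a) * (y' - y)) :=
    mul_nonneg hC.probeCoeff_nonneg (mul_nonneg (sub_nonneg.2 ha) (sub_nonneg.2 hy))
  -- the price term contributes `δ / N` times the product of the increments, which outweighs the
  -- concavity `η / N ^ 2` of the valuation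
  have h3 : η * ((Q' - Q) / N) * ((y' + Q) / N - (y + Q) / N)
      ≤ M.δ * (Q' - Q) * (y' - y) / N := by
    have hp : 0 ≤ (Q' - Q) * (y' - y) / N :=
      div_nonneg (mul_nonneg (sub_nonneg.2 hQ) (sub_nonneg.2 hy)) hN.le
    have hk : η / N ≤ M.δ := (div_le_self hC.eta_pos.le (by linarith)).trans hC.le_price
    have := mul_le_mul_of_nonneg_right hk hp
    calc _ = η / N * ((Q' - Q) * (y' - y) / N) := by field_simp; ring
      _ ≤ _ := this
      _ = _ := by ring
  have h4 : M.probeCoeff * ((a' - a) * (y' - y)) + M.δ * (Q' - Q) * (y' - y) / N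
      = (-(M.δ * (((N : ℝ) - 1) * a' / M.ξ - Q') * ((y' + Q') / N)
          - M.δ * (((N : ℝ) - 1) * a' / M.ξ - Q') * ((y + Q') / N))
        - (M.δ / 2 * (a' - M.ξ * y') ^ 2 - M.δ / 2 * (a' - M.ξ * y) ^ 2))
      - (-(M.δ * (((N : ℝ) - 1) * a / M.ξ - Q) * ((y' + Q) / N)
          - M.δ * (((N : ℝ) - 1) * a / M.ξ - Q) * ((y + Q) / N))
        - (M.δ / 2 * (a - M.ξ * y') ^ 2 - M.δ / 2 * (a - M.ξ * y) ^ 2)) := by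
    have := hC.pos.ne'
    rw [probeCoeff]
    field_simp
    ring
  simp only [contributionPayoff]
  linarith

theorem isSupermodular_payoff {η : ℝ} (hM : M.IsAdmissible) (hC : M.IsContracting η)
    (hv : ∀ i, IsValuation η (v i)) : IsSupermodular (M.payoff v) := by
  constructor
  · intro i m a b
    simp only [hM.payoff_update]
    have h1 := map_sup_add_map_inf
      (M.contributionPayoff v i (M.aggregate i m) (M.probe i m)) a.1 b.1
    have h2 := sq_sup_add_sq_inf_le hC.pos.le (a.2 i) (b.2 i) a.1 b.1
    have h3 : ∀ (s : Finset (Fin N)) (c : Fin N → ℝ),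
        ∑ r ∈ s, ((a ⊔ b).2 r - c r) ^ 2 + ∑ r ∈ s, ((a ⊓ b).2 r - c r) ^ 2
          = ∑ r ∈ s, (a.2 r - c r) ^ 2 + ∑ r ∈ s, (b.2 r - c r) ^ 2 := by
      intro s c
      rw [← Finset.sum_add_distrib, ← Finset.sum_add_distrib]
      exact Finset.sum_congr rfl fun r _ =>
        map_sup_add_map_inf (fun t => (t - c r) ^ 2) (a.2 r) (b.2 r)
    have h4 := h3 (M.nbrs i) fun r => M.ξ * (m r).1
    have h5 := h3 (M.far i) fun r => M.ξ * (m (M.n i r)).2 r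
    simp only [Prod.fst_sup, Prod.fst_inf, Prod.snd_sup, Prod.snd_inf, Pi.sup_apply,
      Pi.inf_apply] at h4 h5 ⊢
    linarith
  · intro i m m' a a' hm ha
    simp only [hM.payoff_update]
    have h1 := contributionPayoff_increasing_differences hM hC i (hv i)
      (hC.aggregate_mono i hm) ((hm (M.n i i)).2 i) ha.1
    have h3 : ∀ (s : Finset (Fin N)) (c c' : Fin N → ℝ), (∀ r, c r ≤ c' r) →
        ∑ r ∈ s, (a'.2 r - M.ξ * c' r) ^ 2 - ∑ r ∈ s, (a.2 r - M.ξ * c' r) ^ 2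
          ≤ ∑ r ∈ s, (a'.2 r - M.ξ * c r) ^ 2 - ∑ r ∈ s, (a.2 r - M.ξ * c r) ^ 2 := by
      intro s c c' hc
      rw [← Finset.sum_sub_distrib, ← Finset.sum_sub_distrib]
      exact Finset.sum_le_sum fun r _ => sq_sub_sq_le hC.pos.le (ha.2 r) (hc r)
    have h4 := h3 (M.nbrs i) (fun r => (m r).1) (fun r => (m' r).1) fun r => (hm r).1
    have h5 := h3 (M.far i) (fun r => (m (M.n i r)).2 r) (fun r => (m' (M.n i r)).2 r)
      fun r => (hm _).2 r
    simp only [probe] at h1 ⊢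
    linarith

/-! ### The best response -/

/-- `ρ i` inverts the left-hand side of the first-order condition of agent `i`. -/
def IsInverseMarginal (M : Params N) (v ρ : Fin N → ℝ → ℝ) : Prop :=
  ∀ i z, M.δ * M.ξ ^ 2 * ρ i z - deriv (v i) (ρ i z / N) / N = z

section Response

variable {η : ℝ} {ρ : Fin N → ℝ → ℝ}

theorem contributionPayoff_lt (hM : M.IsAdmissible) (hC : M.IsContracting η)
    (hv : ∀ i, IsValuation η (v i)) (hρ : M.IsInverseMarginal v ρ) (i : Fin N) (m : Profile N)
    {y : ℝ} (hy : y ≠ (M.response ρ m i).1) :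
    M.contributionPayoff v i (M.aggregate i m) (M.probe i m) y
      < M.contributionPayoff v i (M.aggregate i m) (M.probe i m) (M.response ρ m i).1 := by
  have hN := hM.natCast_pos
  have hξ := hC.pos
  have hδ := hC.delta_pos
  set Q := M.aggregate i m
  set a := M.probe i m
  refine lt_of_hasDerivAt_of_strictAnti (f := M.contributionPayoff v i Q a)
    (f' := fun y => M.target i m
      - (M.δ * M.ξ ^ 2 * (y + Q) - deriv (v i) ((y + Q) / N) / N)) ?_ ?_ ?_ hy
  · intro y
    have h0 : HasDerivAt (fun y : ℝ => (y + Q) / N) (1 / N) y :=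
      ((hasDerivAt_id y).add_const Q).div_const _
    have h1 := ((hv i).differentiable ((y + Q) / N)).hasDerivAt.comp y h0
    have h2 := h0.const_mul (M.δ * (((N : ℝ) - 1) * a / M.ξ - Q))
    have h3 := ((((hasDerivAt_id y).const_mul M.ξ).const_sub a).pow 2).const_mul (M.δ / 2)
    refine ((h1.sub h2).sub h3).congr_deriv ?_
    simp only [target, probeCoeff, id]
    change deriv (v i) ((y + Q) / N) * (1 / N) - _ - _ = M.δ * (1 / N + M.ξ ^ 2) * Q + _ * a - _
    field_simp
    ring
  · intro x y hxy
    obtain ⟨w, hw, e⟩ := (hv i).exists_deriv_sub_eq ((x + Q) / N) ((y + Q) / N)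
    have hw0 : 0 < w := (one_div_pos.2 hC.eta_pos).trans hw.1
    have h1 : 0 < w * ((y + Q) / N - (x + Q) / N) / N := by
      have : (x + Q) / N < (y + Q) / N := by gcongr
      have := sub_pos.2 this
      positivity
    have h2 : deriv (v i) ((y + Q) / N) / N - deriv (v i) ((x + Q) / N) / N
        = -(w * ((y + Q) / N - (x + Q) / N) / N) := by
      rw [← sub_div, e]; ring
    have h3 : M.δ * M.ξ ^ 2 * (x + Q) < M.δ * M.ξ ^ 2 * (y + Q) := by gcongr
    simp only
    linarith
  · have : (M.response ρ m i).1 + Q = ρ i (M.target i m) := sub_add_cancel _ _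
    simp only [this, hρ i, sub_self]

theorem isBestResponse_iff (hM : M.IsAdmissible) (hC : M.IsContracting η)
    (hv : ∀ i, IsValuation η (v i)) (hρ : M.IsInverseMarginal v ρ) (m b : Profile N) :
    IsBestResponse (M.payoff v) m b ↔ b = M.response ρ m := by
  have hself : ∀ i, (M.response ρ m i).2 i - M.ξ * (M.response ρ m i).1 = 0 := by
    intro i
    simp [response]
  have hnbrs : ∀ i, ∀ r ∈ M.nbrs i, (M.response ρ m i).2 r - M.ξ * (m r).1 = 0 := by
    intro i r hr
    simp [response, hM.ne_of_mem_nbrs hr, mem_nbrs.1 hr]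
  have hfar : ∀ i, ∀ r ∈ M.far i,
      (M.response ρ m i).2 r - M.ξ * (m (M.n i r)).2 r = 0 := by
    intro i r hr
    simp [response, (mem_far.1 hr).1, (mem_far.1 hr).2]
  have hval : ∀ i, M.payoff v i (Function.update m i (M.response ρ m i))
      = M.contributionPayoff v i (M.aggregate i m) (M.probe i m) (M.response ρ m i).1 := by
    intro i
    rw [hM.payoff_update, hself, Finset.sum_eq_zero fun r hr => by rw [hnbrs i r hr, sq, zero_mul],
      Finset.sum_eq_zero fun r hr => by rw [hfar i r hr, sq, zero_mul]]
    ring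
  have hle : ∀ i y, M.contributionPayoff v i (M.aggregate i m) (M.probe i m) y
      ≤ M.contributionPayoff v i (M.aggregate i m) (M.probe i m) (M.response ρ m i).1 := by
    intro i y
    rcases eq_or_ne y (M.response ρ m i).1 with h | h
    · rw [h]
    · exact (contributionPayoff_lt hM hC hv hρ i m h).le
  constructor
  · intro hb
    funext i
    have h := hb i (M.response ρ m i)
    rw [hval, hM.payoff_update] at h
    have n0 := sq_nonneg ((b i).2 i - M.ξ * (b i).1)
    have p1 : ∀ r ∈ M.nbrs i, 0 ≤ ((b i).2 r - M.ξ * (m r).1) ^ 2 := fun _ _ => sq_nonneg _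
    have p2 : ∀ r ∈ M.far i, 0 ≤ ((b i).2 r - M.ξ * (m (M.n i r)).2 r) ^ 2 :=
      fun _ _ => sq_nonneg _
    have n1 := Finset.sum_nonneg p1
    have n2 := Finset.sum_nonneg p2
    have hy : (b i).1 = (M.response ρ m i).1 := by
      by_contra hne
      have := contributionPayoff_lt hM hC hv hρ i m hne
      linarith
    rw [hy] at h n0
    have e0 : ((b i).2 i - M.ξ * (M.response ρ m i).1) ^ 2 = 0 := by linarith
    have e1 := (Finset.sum_eq_zero_iff_of_nonneg p1).1 (by linarith)
    have e2 := (Finset.sum_eq_zero_iff_of_nonneg p2).1 (by linarith)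
    refine Prod.ext hy (funext fun r => ?_)
    by_cases hri : r = i
    · subst hri
      linarith [hself r, pow_eq_zero_iff two_ne_zero |>.1 e0]
    · by_cases hadj : M.G.Adj i r
      · have hr := mem_nbrs.2 hadj
        linarith [hnbrs i r hr, pow_eq_zero_iff two_ne_zero |>.1 (e1 r hr)]
      · have hr := mem_far.2 ⟨hadj, hri⟩
        linarith [hfar i r hr, pow_eq_zero_iff two_ne_zero |>.1 (e2 r hr)]
  · rintro rfl i a
    rw [hval, hM.payoff_update]
    have n0 := sq_nonneg (a.2 i - M.ξ * a.1)
    have n1 : 0 ≤ ∑ r ∈ M.nbrs i, (a.2 r - M.ξ * (m r).1) ^ 2 :=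
      Finset.sum_nonneg fun _ _ => sq_nonneg _
    have n2 : 0 ≤ ∑ r ∈ M.far i, (a.2 r - M.ξ * (m (M.n i r)).2 r) ^ 2 :=
      Finset.sum_nonneg fun _ _ => sq_nonneg _
    linarith [hle i a.1]

theorem differentiable_response (hd : ∀ i, Differentiable ℝ (ρ i)) :
    Differentiable ℝ (M.response ρ) := by
  have hQ : ∀ i, Differentiable ℝ (M.aggregate i) := by
    intro i
    unfold aggregate
    fun_prop
  have hy : ∀ i, Differentiable ℝ fun m => ρ i (M.target i m) - M.aggregate i m := by
    intro i
    have := hQ i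
    have := hd i
    unfold target probe
    fun_prop
  refine differentiable_pi.2 fun i => (hy i).prodMk (differentiable_pi.2 fun r => ?_)
  split_ifs
  · exact (hy i).const_mul _
  · fun_prop
  · fun_prop

/-- Increments of the contribution in the best response, by the mean value theorem. -/
theorem exists_increment_contribution (hM : M.IsAdmissible) (hC : M.IsContracting η)
    (hv : ∀ i, IsValuation η (v i)) (hρ : M.IsInverseMarginal v ρ) (i : Fin N)
    (m m' : Profile N) :
    ∃ w ∈ Set.Ioo (1 / (η * N ^ 2)) (η / N ^ 2),
      (M.response ρ m' i).1 - (M.response ρ m i).1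
        = ((M.δ / N - w) * (M.aggregate i m' - M.aggregate i m)
          + M.probeCoeff * (M.probe i m' - M.probe i m)) / (M.δ * M.ξ ^ 2 + w) := by
  have hN := hM.natCast_pos
  have hξ := hC.pos
  have hδ := hC.delta_pos
  obtain ⟨w, ⟨hw1, hw2⟩, e⟩ := (hv i).exists_deriv_sub_eq (ρ i (M.target i m) / N)
    (ρ i (M.target i m') / N)
  have hw0 : 0 < w := (one_div_pos.2 hC.eta_pos).trans hw1
  refine ⟨w / N ^ 2, ⟨?_, by gcongr⟩, ?_⟩
  · rw [← div_div]
    gcongr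
  have hpos : 0 < M.δ * M.ξ ^ 2 + w / N ^ 2 := by positivity
  rw [eq_div_iff hpos.ne']
  have h1 := hρ i (M.target i m)
  have h2 := hρ i (M.target i m')
  set X := ρ i (M.target i m)
  set X' := ρ i (M.target i m')
  have h3 : (M.δ * M.ξ ^ 2 + w / N ^ 2) * (X' - X) = M.target i m' - M.target i m := by
    rw [← h1, ← h2]
    have : deriv (v i) (X' / N) / N - deriv (v i) (X / N) / N = -(w / N ^ 2) * (X' - X) := by
      rw [← sub_div, e]; field_simp
    linarith
  have h4 : (M.response ρ m' i).1 - (M.response ρ m i).1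
      = (X' - X) - (M.aggregate i m' - M.aggregate i m) := by
    simp only [response]; ring
  rw [h4, sub_mul, mul_comm (X' - X), h3]
  simp only [target]
  ring

theorem IsContracting.lt_delta_div (hM : M.IsAdmissible) (hC : M.IsContracting η) {w : ℝ}
    (hw : w < η / N ^ 2) : w < M.δ / N := by
  have hN := hM.natCast_pos
  have hN2 := hM.two_le_cast
  have hη := hC.eta_pos
  refine hw.trans_le ?_
  calc η / N ^ 2 ≤ η / N := by gcongr; nlinarith
    _ ≤ M.δ / N := by gcongr; exact hC.le_price

theorem monotone_response (hM : M.IsAdmissible) (hC : M.IsContracting η)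
    (hv : ∀ i, IsValuation η (v i)) (hρ : M.IsInverseMarginal v ρ) :
    Monotone (M.response ρ) := by
  intro m m' h
  have hy : ∀ i, (M.response ρ m i).1 ≤ (M.response ρ m' i).1 := by
    intro i
    obtain ⟨w, ⟨hw1, hw2⟩, e⟩ := exists_increment_contribution hM hC hv hρ i m m'
    have hN := hM.natCast_pos
    have hη := hC.eta_pos
    have hδ := hC.delta_pos
    have hξ := hC.pos
    have hw0 : 0 < w := lt_trans (by positivity) hw1
    have h1 := mul_nonneg (sub_nonneg.2 (hC.lt_delta_div hM hw2).le)
      (sub_nonneg.2 (hC.aggregate_mono i h))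
    have h2 : 0 ≤ M.probeCoeff * (M.probe i m' - M.probe i m) :=
      mul_nonneg hC.probeCoeff_nonneg (sub_nonneg.2 ((h (M.n i i)).2 i))
    rw [← sub_nonneg, e]
    positivity
  refine fun i => ⟨hy i, fun r => ?_⟩
  have hξ := hC.pos.le
  have hyi := hy i
  simp only [response] at hyi ⊢
  split_ifs
  · exact mul_le_mul_of_nonneg_left hyi hξ
  · exact mul_le_mul_of_nonneg_left (h r).1 hξ
  · exact mul_le_mul_of_nonneg_left ((h _).2 r) hξ

/-- A bound for the row sum of the best-response contribution of agent `i`. -/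
noncomputable def contributionRate (M : Params N) (η : ℝ) (i : Fin N) : ℝ :=
  ((M.δ / N - 1 / (η * N ^ 2)) * M.weight i + M.probeCoeff)
    / (M.δ * M.ξ ^ 2 + 1 / (η * N ^ 2))

theorem contributionRate_lt_one (hM : M.IsAdmissible) (hC : M.IsContracting η) (i : Fin N) :
    M.contributionRate η i < 1 := by
  have hN := hM.natCast_pos
  have hη := hC.eta_pos
  have hδ := hC.delta_pos
  have hξ := hC.pos
  have hw : 0 < 1 / (η * (N : ℝ) ^ 2) := by positivity
  rw [contributionRate, div_lt_one (by positivity), probeCoeff]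
  have h1 := hC.slack_lt i
  have h2 := mul_nonneg hw.le (hC.weight_nonneg i)
  set w := 1 / (η * (N : ℝ) ^ 2)
  have : (M.δ / N - w) * M.weight i + M.δ * (M.ξ - ((N : ℝ) - 1) / (N * M.ξ))
      = M.δ * (M.weight i / N - ((N : ℝ) - 1) / (N * M.ξ) + M.ξ - M.ξ ^ 2) + M.δ * M.ξ ^ 2
        - w * M.weight i := by
    ring
  linarith

theorem abs_contribution_response_sub_le (hM : M.IsAdmissible) (hC : M.IsContracting η)
    (hv : ∀ i, IsValuation η (v i)) (hρ : M.IsInverseMarginal v ρ) (i : Fin N)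
    (m m' : Profile N) :
    |(M.response ρ m' i).1 - (M.response ρ m i).1|
      ≤ M.contributionRate η i * Dist.dist m' m := by
  obtain ⟨w, ⟨hw1, hw2⟩, e⟩ := exists_increment_contribution hM hC hv hρ i m m'
  have hN := hM.natCast_pos
  have hη := hC.eta_pos
  have hδ := hC.delta_pos
  have hξ := hC.pos
  have hS := hC.weight_nonneg i
  have hc := hC.probeCoeff_nonneg
  have hw : 0 < 1 / (η * (N : ℝ) ^ 2) := by positivity
  have hw0 : 0 < w := hw.trans hw1
  have hk : 0 < M.δ / N - w := sub_pos.2 (hC.lt_delta_div hM hw2)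
  have hpos : 0 < M.δ * M.ξ ^ 2 + w := by positivity
  rw [e, abs_div, abs_of_pos hpos, contributionRate, div_mul_eq_mul_div]
  have hnum : |(M.δ / N - w) * (M.aggregate i m' - M.aggregate i m)
      + M.probeCoeff * (M.probe i m' - M.probe i m)|
      ≤ ((M.δ / N - 1 / (η * N ^ 2)) * M.weight i + M.probeCoeff) * Dist.dist m' m := by
    refine (abs_add_le _ _).trans ?_
    rw [abs_mul, abs_mul, abs_of_pos hk, abs_of_nonneg hc, add_mul, mul_assoc]
    refine add_le_add (mul_le_mul (by linarith) (hC.abs_aggregate_sub_le i m m')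
      (abs_nonneg _) (by linarith)) (mul_le_mul_of_nonneg_left (abs_proxy_sub_le m m' _ _) hc)
  exact div_le_div₀ ((abs_nonneg _).trans hnum) hnum (by positivity) (by linarith)

theorem exists_contractingWith_response (hM : M.IsAdmissible) (hC : M.IsContracting η)
    (hv : ∀ i, IsValuation η (v i)) (hρ : M.IsInverseMarginal v ρ) :
    ∃ K : ℝ≥0, ContractingWith K (M.response ρ) := by
  have : NeZero N := ⟨by have := hM.two_le; omega⟩
  obtain ⟨j, hj⟩ := Finite.exists_max (M.contributionRate η)
  set K : ℝ := max M.ξ (M.contributionRate η j)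
  have hK0 : 0 ≤ K := hC.pos.le.trans (le_max_left _ _)
  have hK1 : K < 1 := max_lt hC.lt_one (contributionRate_lt_one hM hC j)
  refine ⟨⟨K, hK0⟩, hK1, LipschitzWith.of_dist_le_mul fun m' m => ?_⟩
  have hD : 0 ≤ Dist.dist m' m := dist_nonneg
  have hy : ∀ i, |(M.response ρ m' i).1 - (M.response ρ m i).1| ≤ K * Dist.dist m' m :=
    fun i => (abs_contribution_response_sub_le hM hC hv hρ i m m').trans
      (mul_le_mul_of_nonneg_right ((hj i).trans (le_max_right _ _)) hD)
  have hscale : ∀ s s' : ℝ, |s' - s| ≤ Dist.dist m' m →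
      |M.ξ * s' - M.ξ * s| ≤ K * Dist.dist m' m := by
    intro s s' h
    rw [← mul_sub, abs_mul, abs_of_pos hC.pos]
    exact mul_le_mul (le_max_left _ _) h (abs_nonneg _) hK0
  have hKD : 0 ≤ K * Dist.dist m' m := mul_nonneg hK0 hD
  refine (dist_pi_le_iff hKD).2 fun i => max_le (hy i) ((dist_pi_le_iff hKD).2 fun r => ?_)
  have hyi := hy i
  rw [Real.dist_eq]
  simp only [response] at hyi ⊢
  split_ifs
  · rw [← mul_sub, abs_mul, abs_of_pos hC.pos]
    exact (mul_le_of_le_one_left (abs_nonneg _) hC.lt_one.le).trans hyi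
  · exact hscale _ _ (abs_contribution_sub_le m m' r)
  · exact hscale _ _ (abs_proxy_sub_le m m' _ r)

end Response

/-! ### The choice of the parameters -/

/-- The slack in the row sum vanishes to first order at `ξ = 1`, where all weights are one; hence
it is negligible against `√(1 - ξ)`. -/
theorem tendsto_slack (hM : M.IsAdmissible) (δ : ℝ → ℝ) (i : Fin N) :
    Tendsto (fun ξ : ℝ => 1 / √(1 - ξ) *
      ((⟨M.G, M.n, ξ, δ ξ⟩ : Params N).weight i / N - ((N : ℝ) - 1) / (N * ξ) + ξ - ξ ^ 2))
      (𝓝[<] 1) (𝓝 0) := by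
  have hN := hM.natCast_pos
  set E : ℝ → ℝ := fun ξ =>
    (⟨M.G, M.n, ξ, δ ξ⟩ : Params N).weight i / N - ((N : ℝ) - 1) / (N * ξ) + ξ - ξ ^ 2 with hE
  have hE1 : E 1 = 0 := by
    have hw : (⟨M.G, M.n, 1, δ 1⟩ : Params N).weight i = N - 1 := by
      rw [← hM.card_nbrs_add_card_far i]
      simp [weight]
      rfl
    simp only [hE, hw]
    ring
  have hd : DifferentiableAt ℝ E 1 := by
    have h1 : DifferentiableAt ℝ (fun ξ : ℝ => (⟨M.G, M.n, ξ, δ ξ⟩ : Params N).weight i) 1 := by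
      change DifferentiableAt ℝ (fun ξ : ℝ => ∑ _r ∈ M.nbrs i, 1 / ξ
        + ∑ r ∈ M.far i, 1 / ξ ^ (PublicGoods.dist M.G i r - 1)) 1
      refine DifferentiableAt.fun_add (DifferentiableAt.fun_sum fun r _ => ?_)
        (DifferentiableAt.fun_sum fun r _ => ?_)
      · exact (differentiableAt_const _).fun_div differentiableAt_id one_ne_zero
      · exact (differentiableAt_const _).fun_div (differentiableAt_id.fun_pow _) (by simp)
    have h2 : DifferentiableAt ℝ (fun ξ : ℝ => ((N : ℝ) - 1) / (N * ξ)) 1 :=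
      (differentiableAt_const _).fun_div (differentiableAt_id.const_mul _) (by simpa using hN.ne')
    exact (((h1.div_const _).fun_sub h2).fun_add differentiableAt_id).fun_sub
      (differentiableAt_id.fun_pow 2)
  have hslope : Tendsto (slope E 1) (𝓝[<] 1) (𝓝 (deriv E 1)) :=
    (hasDerivAt_iff_tendsto_slope.1 hd.hasDerivAt).mono_left
      (nhdsWithin_mono _ fun x hx => ne_of_lt hx)
  have hsqrt : Tendsto (fun ξ : ℝ => -√(1 - ξ)) (𝓝[<] 1) (𝓝 0) := by
    have : Continuous fun ξ : ℝ => -√(1 - ξ) := by fun_prop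
    simpa using (this.tendsto 1).mono_left nhdsWithin_le_nhds
  have hprod := hslope.mul hsqrt
  rw [mul_zero] at hprod
  refine hprod.congr' ?_
  filter_upwards [self_mem_nhdsWithin] with ξ hξ
  have hpos : 0 < 1 - ξ := sub_pos.2 hξ
  have hs := Real.sqrt_pos.2 hpos
  have hne : ξ - 1 ≠ 0 := by linarith
  change slope E 1 ξ * _ = 1 / √(1 - ξ) * E ξ
  rw [slope_def_field, hE1, sub_zero]
  have hsq : √(1 - ξ) * √(1 - ξ) = 1 - ξ := Real.mul_self_sqrt hpos.le
  rw [div_mul_eq_mul_div, one_div_mul_eq_div, div_eq_div_iff hne hs.ne']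
  linear_combination (-E ξ) * hsq

theorem eventually_isContracting (hM : M.IsAdmissible) {η : ℝ} (hη : 1 < η) :
    ∀ᶠ ξ in 𝓝[<] (1 : ℝ),
      (⟨M.G, M.n, ξ, 1 / √(1 - ξ)⟩ : Params N).IsContracting η := by
  have hN := hM.natCast_pos
  have hη0 : 0 < η := by linarith
  have h1 : ∀ᶠ ξ in 𝓝[<] (1 : ℝ), 0 < ξ := nhdsWithin_le_nhds (lt_mem_nhds one_pos)
  have h2 : ∀ᶠ ξ in 𝓝[<] (1 : ℝ), ((N : ℝ) - 1) / N < ξ ^ 2 := by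
    have : Tendsto (fun ξ : ℝ => ξ ^ 2) (𝓝[<] 1) (𝓝 (1 ^ 2)) :=
      ((continuous_pow 2).tendsto 1).mono_left nhdsWithin_le_nhds
    refine this.eventually (lt_mem_nhds ?_)
    rw [one_pow, div_lt_one hN]
    linarith
  have h3 : ∀ᶠ ξ in 𝓝[<] (1 : ℝ), 1 - ξ < (1 / η) ^ 2 := by
    have : Tendsto (fun ξ : ℝ => 1 - ξ) (𝓝[<] 1) (𝓝 (1 - 1)) :=
      ((continuous_const.sub continuous_id).tendsto 1).mono_left nhdsWithin_le_nhds
    refine this.eventually (gt_mem_nhds ?_)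
    rw [sub_self]
    positivity
  have h4 : ∀ᶠ ξ in 𝓝[<] (1 : ℝ), ∀ i, 1 / √(1 - ξ) *
      ((⟨M.G, M.n, ξ, 1 / √(1 - ξ)⟩ : Params N).weight i / N - ((N : ℝ) - 1) / (N * ξ) + ξ - ξ ^ 2)
        < 1 / (η * N ^ 2) :=
    eventually_all.2 fun i =>
      (tendsto_slack hM _ i).eventually (gt_mem_nhds (by positivity))
  filter_upwards [h1, h2, h3, h4, self_mem_nhdsWithin] with ξ h1 h2 h3 h4 h5
  refine ⟨hη, h1, h5, h2.le, ?_, h4⟩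
  have hs : 0 < √(1 - ξ) := Real.sqrt_pos.2 (sub_pos.2 h5)
  have h6 : √(1 - ξ) ≤ 1 / η := Real.sqrt_le_iff.2 ⟨by positivity, h3.le⟩
  exact (le_one_div hη0 hs).2 h6

end Params

end PublicGoods

theorem mainTheorem4 (N : ℕ) (hN : 2 ≤ N) (G : Digraph (Fin N))
    (hloop : ∀ i, ¬ G.Adj i i) (hG : PublicGoods.StronglyConnected G)
    (n : Fin N → Fin N → Fin N) (hn : PublicGoods.IsNextHop G n) :
    ∃ δ : ℝ → ℝ,
      (∀ ξ ∈ Set.Ioo √(((N : ℝ) - 1) / N) 1, 0 < δ ξ) ∧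
      ∀ η : ℝ, 1 < η →
        ∃ ξ₀ ∈ Set.Ico √(((N : ℝ) - 1) / N) 1, ∀ ξ ∈ Set.Ioo ξ₀ 1,
          ∀ v : Fin N → ℝ → ℝ, (∀ i, PublicGoods.IsValuation η (v i)) →
            let u : Fin N → PublicGoods.Profile N → ℝ :=
              PublicGoods.Params.payoff ⟨G, n, ξ, δ ξ⟩ v
            PublicGoods.IsSupermodular u ∧
            ∃ β : PublicGoods.Profile N → PublicGoods.Profile N,
              -- the best response exists, is single-valued, and is given by `β`
              (∀ m b, PublicGoods.IsBestResponse u m b ↔ b = β m) ∧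
              -- `β` is a contraction in the row-sum norm of the Jacobian
              Differentiable ℝ β ∧
              (∃ K : ℝ≥0, K < 1 ∧
                (∀ m, PublicGoods.rowSumNorm (PublicGoods.jacobian β m) ≤ K) ∧
                ContractingWith K β) ∧
              -- best responses are nondecreasing in the messages of the other agents
              Monotone β ∧
              -- there is a unique Nash equilibrium, and all ABR dynamics converge to it
              ∃ mNE : PublicGoods.Profile N,
                (∀ m, PublicGoods.IsNash u m ↔ m = mNE) ∧
                ∀ (μ : ℕ → Fin N → ProbabilityMeasure (PublicGoods.Msg N))
                  (m : ℕ → PublicGoods.Profile N),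
                  PublicGoods.IsABR β mNE μ m →
                    Tendsto m atTop (𝓝 mNE) ∧
                    ∀ ε > 0, ∀ᶠ t in atTop,
                      PublicGoods.mixedSupport (μ t) ⊆ Metric.closedBall mNE ε := by
  let M₀ : PublicGoods.Params N := ⟨G, n, 1, 1⟩
  have hM₀ : M₀.IsAdmissible := ⟨hN, hloop, hn.1⟩
  have hN0 : (0 : ℝ) < N := hM₀.natCast_pos
  have : NeZero N := ⟨by omega⟩
  refine ⟨fun ξ => 1 / √(1 - ξ), fun ξ hξ =>
    one_div_pos.2 (Real.sqrt_pos.2 (sub_pos.2 hξ.2)), fun η hη => ?_⟩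
  have hlt : √(((N : ℝ) - 1) / N) < 1 := by
    rw [Real.sqrt_lt' one_pos, one_pow, div_lt_one hN0]
    linarith
  obtain ⟨ξ₀, hξ₀, hsub⟩ := (mem_nhdsLT_iff_exists_mem_Ico_Ioo_subset hlt).1
    (PublicGoods.Params.eventually_isContracting hM₀ hη)
  refine ⟨ξ₀, hξ₀, fun ξ hξ v hv => ?_⟩
  set M : PublicGoods.Params N := ⟨G, n, ξ, 1 / √(1 - ξ)⟩
  have hM : M.IsAdmissible := ⟨hN, hloop, hn.1⟩
  have hC : M.IsContracting η := hsub hξ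
  have hκ : 0 < M.δ * M.ξ ^ 2 := mul_pos hC.delta_pos (pow_pos hC.pos 2)
  choose ρ hρd hρ using fun i => (hv i).exists_inverse_marginal hC.eta_pos hκ hN0
  have hbest := PublicGoods.Params.isBestResponse_iff hM hC hv hρ
  have hmono := PublicGoods.Params.monotone_response hM hC hv hρ
  have hdiff : Differentiable ℝ (M.response ρ) :=
    PublicGoods.Params.differentiable_response hρd
  obtain ⟨K, hK⟩ := PublicGoods.Params.exists_contractingWith_response hM hC hv hρ
  have hfix : M.response ρ hK.fixedPoint = hK.fixedPoint := hK.fixedPoint_isFixedPt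
  refine ⟨PublicGoods.Params.isSupermodular_payoff hM hC hv, M.response ρ, hbest, hdiff,
    ⟨K, hK.1, fun m => PublicGoods.rowSumNorm_jacobian_le hmono hK.2 m (hdiff m), hK⟩, hmono,
    hK.fixedPoint, fun m => ?_, fun μ m h => ⟨h.tendsto hK hfix, fun ε hε =>
      h.eventually_subset hK hfix hε⟩⟩
  have hNash : PublicGoods.IsNash (M.payoff v) m
      ↔ PublicGoods.IsBestResponse (M.payoff v) m m := by
    simp only [PublicGoods.IsNash, PublicGoods.IsBestResponse, Function.update_eq_self]
  rw [hNash, hbest]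
  exact ⟨fun h => hK.fixedPoint_unique h.symm, fun h => h ▸ hfix.symm⟩
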